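/- Let $U\subset\mathbb{R}^3$ be open and connected. A triply orthogonal system on $U$ is a smooth map $f:U\to\mathbb{R}^3$ with $\det(\partial_1f,\partial_2f,\partial_3f)\neq0$ and $(\partial_if,\partial_jf)=0$ for $i\ne j$. Put $N_i=\frac{\partial_jf\times\partial_kf}{|\partial_jf\times\partial_kf|}$ for $(i,j,k)$ cyclic, and define its Lamé coefficients $H_i$ by $\partial_if=H_iN_i$ and its rotational coefficients by $\beta_{ij}=\frac{1}{H_i}\partial_iH_j$ ($i\neq j$). It is a $\chi$-system if $H_1^2+H_2^2-H_3^2=\chi$, and a Guichard net if $\chi=0$. Two triply orthogonal systems $f,g$ are related by a Combescure transformation if $\partial_ig$ is parallel to $\partial_if$ for every $i$. Let $f,f'$ be triply orthogonal systems on $U$ forming a Ribaucour pair, described by smooth functions $\gamma_1,\gamma_2,\gamma_3,\varphi$ on $U$ with $$\partial_i\gamma_j=\beta_{ji}\gamma_i\ (i\neq j),\qquad \partial_i\varphi=H_i\gamma_i,\qquad A:=\gamma_1^2+\gamma_2^2+\gamma_3^2\neq0,\qquad f'=f-\frac{2\varphi}{A}(\gamma_1N_1+\gamma_2N_2+\gamma_3N_3).$$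 Put $\theta_i=\partial_i\gamma_i+\beta_{ji}\gamma_j+\beta_{ki}\gamma_k$ and $H_i'=H_i-\frac{2\varphi\theta_i}{A}$ (so $|H_i'|=|\partial_if'|$). The induced Combescure transforms of the pair are $$\bar f=\gamma_1N_1+\gamma_2N_2+\gamma_3N_3,\qquad \bar f'=\frac{\bar f}{|\bar f|^2}.$$ Proposition. If $f$ and $f'$ are Guichard nets, then there are a constant $\alpha\in\mathbb{R}$ and a sign $\sigma\in\{1,-1\}$ such that $\sigma H_3H_3'>0$ on all of $U$ and $$|\partial_1\bar f|^2+|\partial_2\bar f|^2-|\partial_3\bar f|^2=\sigma\alpha^2|\bar f|^2,\qquad |\partial_1\bar f'|^2+|\partial_2\bar f'|^2-|\partial_3\bar f'|^2=\sigma\alpha^2|\bar f'|^2 .$$ If moreover no $\theta_i$ vanishes anywhere on $U$, then $\bar f$ and $\bar f'$ are triply orthogonal systems, Combescure transforms of $f$ and $f'$ respectively, and are $\sigma\alpha^2|\bar f|^2$- and $\sigma\alpha^2|\bar f'|^2$-systems, respectively. In particular, if $H_3$ and $H_3'$ have the same sign, they are $\alpha^2|\bar f|^2$- and $\alpha^2|\bar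 f'|^2$-systems with $\alpha\in\mathbb{R}$. -/

import Mathlib

open scoped ContDiff

noncomputable section

namespace TriplyOrthogonal

/-- Euclidean three-space; it contains both the parameter domains and the target. -/
abbrev E3 := EuclideanSpace ℝ (Fin 3)

/-- The partial derivative `∂ᵢ g`. -/
def pd {F : Type*} [NormedAddCommGroup F] [NormedSpace ℝ F] (i : Fin 3) (g : E3 → F) (x : E3) : F :=
  fderiv ℝ g x (EuclideanSpace.single i 1)

/-- The vector product of `ℝ³`. -/
def cross (u v : E3) : E3 :=
  WithLp.toLp 2 (crossProduct (WithLp.ofLp u) (WithLp.ofLp v))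

/-- A (smooth) triply orthogonal system on `U`: `det (∂₁f, ∂₂f, ∂₃f) ≠ 0` and
`(∂ᵢf, ∂ⱼf) = 0` for `i ≠ j`. -/
structure IsTOS (U : Set E3) (f : E3 → E3) : Prop where
  smooth : ContDiffOn ℝ ∞ f U
  det_ne_zero : ∀ x ∈ U, (Matrix.of fun i j : Fin 3 => pd i f x j).det ≠ 0
  orthogonal : ∀ x ∈ U, ∀ i j : Fin 3, i ≠ j → inner ℝ (pd i f x) (pd j f x) = 0

/-- The unit normal `Nᵢ = ∂ⱼf × ∂ₖf / |∂ⱼf × ∂ₖf|` of the coordinate surfaces `xᵢ = const`.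
Indices in `Fin 3` are cyclic, so `(i, i+1, i+2)` is a cyclic permutation of `(0, 1, 2)`. -/
def unitNormal (f : E3 → E3) (i : Fin 3) (x : E3) : E3 :=
  (‖cross (pd (i + 1) f x) (pd (i + 2) f x)‖)⁻¹ • cross (pd (i + 1) f x) (pd (i + 2) f x)

/-- The Lamé coefficient `Hᵢ`, determined by `∂ᵢf = Hᵢ Nᵢ`. -/
def lame (f : E3 → E3) (i : Fin 3) (x : E3) : ℝ :=
  inner ℝ (pd i f x) (unitNormal f i x)

/-- The rotational coefficient `βᵢⱼ = ∂ᵢHⱼ / Hᵢ`. -/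
def rot (f : E3 → E3) (i j : Fin 3) (x : E3) : ℝ :=
  pd i (lame f j) x / lame f i x

/-- A `χ`-system: a triply orthogonal system with `H₁² + H₂² - H₃² = χ`. -/
structure IsChiSystem (U : Set E3) (χ : E3 → ℝ) (f : E3 → E3) : Prop where
  tos : IsTOS U f
  trace : ∀ x ∈ U, lame f 0 x ^ 2 + lame f 1 x ^ 2 - lame f 2 x ^ 2 = χ x

/-- A Guichard net is a `0`-system. -/
def IsGuichardNet (U : Set E3) (f : E3 → E3) : Prop :=
  IsChiSystem U (fun _ => 0) f

/-- Two triply orthogonal systems are related by a Combescure transformation if corresponding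
coordinate curves (hence corresponding coordinate surfaces) have parallel tangents. -/
structure IsCombescurePair (U : Set E3) (f g : E3 → E3) : Prop where
  tos_left : IsTOS U f
  tos_right : IsTOS U g
  parallel : ∀ x ∈ U, ∀ i : Fin 3, ∃ h : ℝ, pd i g x = h • pd i f x

/-- `A = γ₁² + γ₂² + γ₃²`. -/
def normSqData (γ : Fin 3 → E3 → ℝ) (x : E3) : ℝ :=
  ∑ i, γ i x ^ 2

/-- `θᵢ = ∂ᵢγᵢ + βⱼᵢ γⱼ + βₖᵢ γₖ`. -/
def theta (f : E3 → E3) (γ : Fin 3 → E3 → ℝ) (i : Fin 3) (x : E3) : ℝ :=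
  pd i (γ i) x + rot f (i + 1) i x * γ (i + 1) x + rot f (i + 2) i x * γ (i + 2) x

/-- The induced map `f̄ = γ₁N₁ + γ₂N₂ + γ₃N₃`. -/
def inducedBar (f : E3 → E3) (γ : Fin 3 → E3 → ℝ) (x : E3) : E3 :=
  ∑ i, γ i x • unitNormal f i x

/-- The induced map `f̄' = f̄ / |f̄|²`. -/
def inducedBar' (f : E3 → E3) (γ : Fin 3 → E3 → ℝ) (x : E3) : E3 :=
  (‖inducedBar f γ x‖ ^ 2)⁻¹ • inducedBar f γ x

/-- `(f, f')` is the Ribaucour pair of triply orthogonal systems described by `γ₁, γ₂, γ₃, φ`. -/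
structure IsRibaucourPair (U : Set E3) (f f' : E3 → E3) (γ : Fin 3 → E3 → ℝ) (φ : E3 → ℝ) :
    Prop where
  tos_left : IsTOS U f
  tos_right : IsTOS U f'
  smooth_γ : ∀ i, ContDiffOn ℝ ∞ (γ i) U
  smooth_φ : ContDiffOn ℝ ∞ φ U
  deriv_γ : ∀ x ∈ U, ∀ i j : Fin 3, i ≠ j → pd i (γ j) x = rot f j i x * γ i x
  deriv_φ : ∀ x ∈ U, ∀ i : Fin 3, pd i φ x = lame f i x * γ i x
  normSq_ne_zero : ∀ x ∈ U, normSqData γ x ≠ 0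
  transform : ∀ x ∈ U, f' x = f x - (2 * φ x / normSqData γ x) • inducedBar f γ x

/-- `Hᵢ' = Hᵢ - 2φθᵢ/A`: the Lamé coefficients of the Ribaucour transform with respect to the
normals `Nᵢ' = Nᵢ - (2γᵢ/A) f̄`, that is, `∂ᵢf' = Hᵢ' Nᵢ'`. -/
def ribaucourLame (f : E3 → E3) (γ : Fin 3 → E3 → ℝ) (φ : E3 → ℝ) (i : Fin 3) (x : E3) : ℝ :=
  lame f i x - 2 * φ x * theta f γ i x / normSqData γ x

/-- The trace `|∂₁g|² + |∂₂g|² - |∂₃g|²` of the metric induced by a possibly degenerate map. -/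
def minkowskiTrace (g : E3 → E3) (x : E3) : ℝ :=
  ‖pd 0 g x‖ ^ 2 + ‖pd 1 g x‖ ^ 2 - ‖pd 2 g x‖ ^ 2

end TriplyOrthogonal

end

open scoped ContDiff

noncomputable section

namespace TriplyOrthogonal

/-! ### Coordinate partial derivatives. -/

section Calculus

variable {F : Type*} [NormedAddCommGroup F] [NormedSpace ℝ F]

/-! Let `ε = (1, 1, -1)`, `S = ∑ εᵢθᵢ²` and `P = ∑ εᵢHᵢθᵢ`. The frame equations give `∂ᵢf̄ = θᵢNᵢ`,
and inversion gives `∂ᵢf̄' = (θᵢ/A)Nᵢ'`, where `Nᵢ'` is `Nᵢ` reflected along `f̄`; also `∂ᵢf' =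
Hᵢ'Nᵢ'`. Since `A = |f̄|²`, both trace formulas amount to `S = cA` with `c = σα²` constant.

Subtracting the two Guichard conditions gives `φS = AP` (`diagForm_theta_mul`). The `θᵢ` satisfy the
same equations `∂ᵢθⱼ = βᵢⱼθᵢ` as the Lamé coefficients (`pd_theta`), so `∂ᵢS = 2θᵢT` and `∂ᵢP = HᵢT`
with a common factor `T`. Differentiating `φS = AP` then yields `AHᵢ'(AT - γᵢS) = 0`. As `Hᵢ' ≠ 0`
and `∂ᵢA = 2γᵢθᵢ`, it follows that `A ∂ᵢS = S ∂ᵢA`, and `S/A` is constant on the connected set `U`.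

For the sign, `∑ εᵢHᵢHᵢ' = -2φ²c/A`. Both `H` and `H'` are null for the Minkowski form, so by
Cauchy–Schwarz this sum has sign opposite to `H₃H₃'` or vanishes (`mul_minkowski_nonpos`). Hence `σc
≥ 0`, and `α = √(σc)` works. -/

theorem differentiableAt_of_contDiffOn {U : Set E3} (hU : IsOpen U) {g : E3 → F}
    (hg : ContDiffOn ℝ ∞ g U) {x : E3} (hx : x ∈ U) : DifferentiableAt ℝ g x :=
  (hg.contDiffAt (hU.mem_nhds hx)).differentiableAt (by simp)

theorem contDiffOn_pd {U : Set E3} (hU : IsOpen U) {g : E3 → F}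
    (hg : ContDiffOn ℝ ∞ g U) (i : Fin 3) : ContDiffOn ℝ ∞ (pd i g) U :=
  (hg.fderiv_of_isOpen hU (m := ∞) (by simp)).clm_apply contDiffOn_const

theorem pd_congr_of_isOpen {U : Set E3} (hU : IsOpen U) {g h : E3 → F}
    (hgh : ∀ x ∈ U, g x = h x) {x : E3} (hx : x ∈ U) (i : Fin 3) : pd i g x = pd i h x := by
  have : g =ᶠ[nhds x] h := Filter.eventuallyEq_of_mem (hU.mem_nhds hx) hgh
  rw [pd, pd, this.fderiv_eq]

theorem pd_comm {U : Set E3} (hU : IsOpen U) {g : E3 → F}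
    (hg : ContDiffOn ℝ ∞ g U) {x : E3} (hx : x ∈ U) (i j : Fin 3) :
    pd i (pd j g) x = pd j (pd i g) x := by
  have hd : DifferentiableAt ℝ (fderiv ℝ g) x :=
    differentiableAt_of_contDiffOn hU
      (hg.fderiv_of_isOpen hU (m := ∞) (by simp)) hx
  have hs : IsSymmSndFDerivAt ℝ g x :=
    (hg.contDiffAt (hU.mem_nhds hx)).isSymmSndFDerivAt
      (by simpa using (WithTop.coe_le_coe.2 le_top : ((2 : ℕ∞) : WithTop ℕ∞) ≤ ∞))
  have key : ∀ a b : Fin 3, pd a (pd b g) x =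
      fderiv ℝ (fderiv ℝ g) x (EuclideanSpace.single a 1) (EuclideanSpace.single b 1) := by
    intro a b
    change fderiv ℝ (fun y => fderiv ℝ g y (EuclideanSpace.single b 1)) x _ = _
    rw [fderiv_clm_apply hd (differentiableAt_const _)]
    simp
  rw [key, key, hs.eq]

theorem pd_const (i : Fin 3) (c : F) (x : E3) : pd i (fun _ => c) x = 0 := by
  simp [pd]

theorem pd_sub {g h : E3 → F} {x : E3} (hg : DifferentiableAt ℝ g x)
    (hh : DifferentiableAt ℝ h x) (i : Fin 3) :
    pd i (fun y => g y - h y) x = pd i g x - pd i h x := by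
  simp [pd, fderiv_fun_sub hg hh]

theorem pd_sum {ι : Type*} (s : Finset ι) {g : ι → E3 → F} {x : E3}
    (hg : ∀ k, DifferentiableAt ℝ (g k) x) (i : Fin 3) :
    pd i (fun y => ∑ k ∈ s, g k y) x = ∑ k ∈ s, pd i (g k) x := by
  simp [pd, fderiv_fun_sum (fun k _ => hg k)]

theorem pd_smul {a : E3 → ℝ} {g : E3 → F} {x : E3} (ha : DifferentiableAt ℝ a x)
    (hg : DifferentiableAt ℝ g x) (i : Fin 3) :
    pd i (fun y => a y • g y) x = a x • pd i g x + pd i a x • g x := by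
  simp [pd, fderiv_fun_smul ha hg]

theorem pd_mul {a b : E3 → ℝ} {x : E3} (ha : DifferentiableAt ℝ a x)
    (hb : DifferentiableAt ℝ b x) (i : Fin 3) :
    pd i (fun y => a y * b y) x = a x * pd i b x + pd i a x * b x :=
  pd_smul ha hb i

theorem pd_inv {a : E3 → ℝ} {x : E3} (ha : DifferentiableAt ℝ a x) (h0 : a x ≠ 0) (i : Fin 3) :
    pd i (fun y => (a y)⁻¹) x = -pd i a x / a x ^ 2 := by
  have h := (hasDerivAt_inv h0).comp_hasFDerivAt x ha.hasFDerivAt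
  have h2 : fderiv ℝ (fun y => (a y)⁻¹) x = _ := h.fderiv
  rw [pd, h2]
  simp [pd]
  ring

theorem pd_inner {g h : E3 → E3} {x : E3} (hg : DifferentiableAt ℝ g x)
    (hh : DifferentiableAt ℝ h x) (i : Fin 3) :
    pd i (fun y => inner ℝ (g y) (h y)) x
      = inner ℝ (g x) (pd i h x) + inner ℝ (pd i g x) (h x) := by
  simp [pd, fderiv_inner_apply ℝ hg hh]

theorem fderiv_eq_zero_of_pd {g : E3 → F} {x : E3} (h : ∀ i, pd i g x = 0) :
    fderiv ℝ g x = 0 := by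
  have : (fderiv ℝ g x : E3 →ₗ[ℝ] F) = 0 := by
    refine (EuclideanSpace.basisFun (Fin 3) ℝ).toBasis.ext fun i => ?_
    simpa [pd] using h i
  ext v
  exact LinearMap.congr_fun this v

end Calculus

/-! ### Orthonormal frames and the vector product. -/

section Frame

theorem sum_fin_three_cyclic {M : Type*} [AddCommMonoid M] (g : Fin 3 → M) (i : Fin 3) :
    ∑ j, g j = g i + g (i + 1) + g (i + 2) := by
  fin_cases i
  · simp [Fin.sum_univ_three]
  · simp [Fin.sum_univ_three]; abel
  · simp [Fin.sum_univ_three]; abel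

theorem eq_of_inner_orthonormal {N : Fin 3 → E3} (hN : Orthonormal ℝ N) {v w : E3}
    (h : ∀ k, inner ℝ v (N k) = inner ℝ w (N k)) : v = w := by
  let b := basisOfOrthonormalOfCardEqFinrank hN (by simp)
  refine InnerProductSpace.ext_inner_right_basis b fun k => ?_
  simpa [b] using h k

theorem inner_E3 (u v : E3) : inner ℝ u v = u 0 * v 0 + u 1 * v 1 + u 2 * v 2 := by
  simp [PiLp.inner_apply, Fin.sum_univ_three]; ring

/-- The determinant is the triple product of `p i` with this vector product. -/
theorem cross_ne_zero_of_det {p : Fin 3 → E3}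
    (hp : (Matrix.of fun i j : Fin 3 => p i j).det ≠ 0) (i : Fin 3) :
    cross (p (i + 1)) (p (i + 2)) ≠ 0 := by
  intro h
  apply hp
  have h0 := congrArg (fun v : E3 => v 0) h
  have h1 := congrArg (fun v : E3 => v 1) h
  have h2 := congrArg (fun v : E3 => v 2) h
  simp [cross, crossProduct] at h0 h1 h2
  rw [Matrix.det_fin_three]
  simp only [Matrix.of_apply]
  fin_cases i <;> simp at h0 h1 h2
  · linear_combination p 0 0 * h0 + p 0 1 * h1 + p 0 2 * h2
  · linear_combination p 1 0 * h0 + p 1 1 * h1 + p 1 2 * h2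
  · linear_combination p 2 0 * h0 + p 2 1 * h1 + p 2 2 * h2

theorem eq_inner_smul_cross {p a b : E3} (ha : inner ℝ p a = 0) (hb : inner ℝ p b = 0)
    (hn : cross a b ≠ 0) :
    p = inner ℝ p (‖cross a b‖⁻¹ • cross a b) • ‖cross a b‖⁻¹ • cross a b := by
  have hn' : ‖cross a b‖ ≠ 0 := norm_ne_zero_iff.2 hn
  -- With `n = a × b`, this is `|n|²p - (p, n)n = n × (p × n)` together with `p × n = (p, b)a - (p,
  -- a)b = 0`.
  have key : (‖cross a b‖ ^ 2) • p = inner ℝ p (cross a b) • cross a b := by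
    rw [← real_inner_self_eq_norm_sq]
    simp only [inner_E3] at *
    ext c
    fin_cases c <;> simp [cross, crossProduct]
    · linear_combination ((a 2 * b 0 - a 0 * b 2) * a 2 - (a 0 * b 1 - a 1 * b 0) * a 1) * hb -
        ((a 2 * b 0 - a 0 * b 2) * b 2 - (a 0 * b 1 - a 1 * b 0) * b 1) * ha
    · linear_combination ((a 0 * b 1 - a 1 * b 0) * a 0 - (a 1 * b 2 - a 2 * b 1) * a 2) * hb -
        ((a 0 * b 1 - a 1 * b 0) * b 0 - (a 1 * b 2 - a 2 * b 1) * b 2) * ha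
    · linear_combination ((a 1 * b 2 - a 2 * b 1) * a 1 - (a 2 * b 0 - a 0 * b 2) * a 0) * hb -
        ((a 1 * b 2 - a 2 * b 1) * b 1 - (a 2 * b 0 - a 0 * b 2) * b 0) * ha
  rw [real_inner_smul_right, smul_smul]
  have : p = (‖cross a b‖ ^ 2)⁻¹ • inner ℝ p (cross a b) • cross a b := by
    rw [← key, smul_smul, inv_mul_cancel₀ (by positivity), one_smul]
  conv_lhs => rw [this]
  rw [smul_smul]
  congr 1
  ring

end Frame

/-! ### The frame equations of a triply orthogonal system. -/

section TriplyOrthogonalSystem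

variable {U : Set E3} {f : E3 → E3} {x : E3}

theorem fin_three_cases {i j : Fin 3} (h : i ≠ j) : j = i + 1 ∨ j = i + 2 := by
  revert i j; decide

theorem contDiff_cross : ContDiff ℝ ∞ (fun p : E3 × E3 => cross p.1 p.2) := by
  rw [contDiff_euclidean]
  intro i
  fin_cases i <;> simp [cross, crossProduct] <;> fun_prop

namespace IsTOS

theorem cross_ne_zero (hf : IsTOS U f) (hx : x ∈ U) (i : Fin 3) :
    cross (pd (i + 1) f x) (pd (i + 2) f x) ≠ 0 :=
  cross_ne_zero_of_det (p := fun k => pd k f x) (hf.det_ne_zero x hx) i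

theorem pd_eq (hf : IsTOS U f) (hx : x ∈ U) (i : Fin 3) :
    pd i f x = lame f i x • unitNormal f i x :=
  eq_inner_smul_cross (hf.orthogonal x hx _ _ (by revert i; decide))
    (hf.orthogonal x hx _ _ (by revert i; decide)) (hf.cross_ne_zero hx i)

theorem norm_unitNormal (hf : IsTOS U f) (hx : x ∈ U) (i : Fin 3) : ‖unitNormal f i x‖ = 1 := by
  rw [unitNormal, norm_smul, norm_inv, norm_norm,
    inv_mul_cancel₀ (norm_ne_zero_iff.2 (hf.cross_ne_zero hx i))]

theorem pd_ne_zero (hf : IsTOS U f) (hx : x ∈ U) (i : Fin 3) : pd i f x ≠ 0 := by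
  intro h
  refine hf.det_ne_zero x hx (Matrix.det_eq_zero_of_row_eq_zero i fun j => ?_)
  simp [h]

theorem lame_ne_zero (hf : IsTOS U f) (hx : x ∈ U) (i : Fin 3) : lame f i x ≠ 0 := by
  intro h
  have := hf.pd_eq hx i
  rw [h, zero_smul] at this
  exact hf.pd_ne_zero hx i this

theorem lame_sq (hf : IsTOS U f) (hx : x ∈ U) (i : Fin 3) : lame f i x ^ 2 = ‖pd i f x‖ ^ 2 := by
  rw [hf.pd_eq hx i, norm_smul, hf.norm_unitNormal hx, mul_one, Real.norm_eq_abs, sq_abs]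

theorem orthonormal_unitNormal (hf : IsTOS U f) (hx : x ∈ U) :
    Orthonormal ℝ (fun i => unitNormal f i x) := by
  refine ⟨hf.norm_unitNormal hx, fun i j hij => ?_⟩
  have h := hf.orthogonal x hx i j hij
  rw [hf.pd_eq hx i, hf.pd_eq hx j, real_inner_smul_left, real_inner_smul_right] at h
  simpa [hf.lame_ne_zero hx] using h

theorem inner_unitNormal (hf : IsTOS U f) (hx : x ∈ U) (i j : Fin 3) :
    inner ℝ (unitNormal f i x) (unitNormal f j x) = if i = j then 1 else 0 :=
  orthonormal_iff_ite.1 (hf.orthonormal_unitNormal hx) i j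

theorem contDiffOn_unitNormal (hf : IsTOS U f) (hU : IsOpen U) (i : Fin 3) :
    ContDiffOn ℝ ∞ (unitNormal f i) U := by
  have hc : ContDiffOn ℝ ∞ (fun x => cross (pd (i + 1) f x) (pd (i + 2) f x)) U :=
    contDiff_cross.comp_contDiffOn
      ((contDiffOn_pd hU hf.smooth (i + 1)).prodMk (contDiffOn_pd hU hf.smooth (i + 2)))
  have hn := hc.norm ℝ fun y hy => hf.cross_ne_zero hy i
  exact (hn.inv fun y hy => norm_ne_zero_iff.2 (hf.cross_ne_zero hy i)).smul hc

theorem contDiffOn_lame (hf : IsTOS U f) (hU : IsOpen U) (i : Fin 3) :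
    ContDiffOn ℝ ∞ (lame f i) U :=
  (contDiffOn_pd hU hf.smooth i).inner ℝ (hf.contDiffOn_unitNormal hU i)

theorem contDiffOn_rot (hf : IsTOS U f) (hU : IsOpen U) (i j : Fin 3) :
    ContDiffOn ℝ ∞ (rot f i j) U :=
  (contDiffOn_pd hU (hf.contDiffOn_lame hU j) i).div (hf.contDiffOn_lame hU i)
    fun _ hy => hf.lame_ne_zero hy i

theorem differentiableAt_unitNormal (hf : IsTOS U f) (hU : IsOpen U) (hx : x ∈ U) (i : Fin 3) :
    DifferentiableAt ℝ (unitNormal f i) x :=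
  differentiableAt_of_contDiffOn hU (hf.contDiffOn_unitNormal hU i) hx

theorem differentiableAt_lame (hf : IsTOS U f) (hU : IsOpen U) (hx : x ∈ U) (i : Fin 3) :
    DifferentiableAt ℝ (lame f i) x :=
  differentiableAt_of_contDiffOn hU (hf.contDiffOn_lame hU i) hx

theorem pd_lame (hf : IsTOS U f) (hx : x ∈ U) (i j : Fin 3) :
    pd i (lame f j) x = rot f i j x * lame f i x := by
  rw [rot, div_mul_cancel₀ _ (hf.lame_ne_zero hx i)]

theorem inner_pd_unitNormal_antisymm (hf : IsTOS U f) (hU : IsOpen U) (hx : x ∈ U)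
    (i j k : Fin 3) :
    inner ℝ (pd i (unitNormal f j) x) (unitNormal f k x) =
      -inner ℝ (pd i (unitNormal f k) x) (unitNormal f j x) := by
  have h1 := pd_inner (hf.differentiableAt_unitNormal hU hx j)
    (hf.differentiableAt_unitNormal hU hx k) i
  rw [pd_congr_of_isOpen hU (fun y hy => hf.inner_unitNormal hy j k) hx i, pd_const,
    real_inner_comm] at h1
  linarith

theorem inner_pd_unitNormal_self (hf : IsTOS U f) (hU : IsOpen U) (hx : x ∈ U) (i j : Fin 3) :
    inner ℝ (pd i (unitNormal f j) x) (unitNormal f j x) = 0 := by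
  linarith [hf.inner_pd_unitNormal_antisymm hU hx i j j]

theorem pd_pd (hf : IsTOS U f) (hU : IsOpen U) (hx : x ∈ U) (i j : Fin 3) :
    pd i (pd j f) x =
      lame f j x • pd i (unitNormal f j) x + pd i (lame f j) x • unitNormal f j x := by
  rw [pd_congr_of_isOpen hU (fun y hy => hf.pd_eq hy j) hx i,
    pd_smul (hf.differentiableAt_lame hU hx j) (hf.differentiableAt_unitNormal hU hx j)]

theorem inner_pd_pd (hf : IsTOS U f) (hU : IsOpen U) (hx : x ∈ U) (i j k : Fin 3) :
    inner ℝ (pd i (pd j f) x) (unitNormal f k x) =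
      lame f j x * inner ℝ (pd i (unitNormal f j) x) (unitNormal f k x) +
        pd i (lame f j) x * if j = k then 1 else 0 := by
  rw [hf.pd_pd hU hx, inner_add_left, real_inner_smul_left, real_inner_smul_left,
    hf.inner_unitNormal hx]

theorem lame_mul_inner_pd_unitNormal_comm (hf : IsTOS U f) (hU : IsOpen U) (hx : x ∈ U)
    (i j k : Fin 3) :
    lame f j x * inner ℝ (pd i (unitNormal f j) x) (unitNormal f k x) +
        (pd i (lame f j) x * if j = k then 1 else 0) =
      lame f i x * inner ℝ (pd j (unitNormal f i) x) (unitNormal f k x) +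
        pd j (lame f i) x * if i = k then 1 else 0 := by
  rw [← hf.inner_pd_pd hU hx, ← hf.inner_pd_pd hU hx, pd_comm hU hf.smooth hx]

/-- Dupin's theorem: the coordinate curves are curvature lines of the coordinate surfaces. -/
theorem inner_pd_unitNormal_of_ne (hf : IsTOS U f) (hU : IsOpen U) (hx : x ∈ U)
    {i j k : Fin 3} (hij : i ≠ j) (hjk : j ≠ k) (hik : i ≠ k) :
    inner ℝ (pd i (unitNormal f j) x) (unitNormal f k x) = 0 := by
  have h1 := hf.lame_mul_inner_pd_unitNormal_comm hU hx i j k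
  have h2 := hf.lame_mul_inner_pd_unitNormal_comm hU hx j k i
  have h3 := hf.lame_mul_inner_pd_unitNormal_comm hU hx k i j
  have a1 := hf.inner_pd_unitNormal_antisymm hU hx i j k
  have a2 := hf.inner_pd_unitNormal_antisymm hU hx j k i
  have a3 := hf.inner_pd_unitNormal_antisymm hU hx k i j
  simp only [hij, hjk, hik, hij.symm, hjk.symm, hik.symm, if_false, mul_zero, add_zero] at h1 h2 h3
  -- Each use of symmetry of mixed partials followed by antisymmetry shifts the indices cyclically
  -- and changes the sign; after three shifts the quantity equals its own negative.
  have h : lame f j x * lame f k x *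
      inner ℝ (pd i (unitNormal f j) x) (unitNormal f k x) = 0 := by
    linear_combination (lame f k x * h1 - lame f i x * h2 + lame f j x * h3
      + lame f i x * lame f k x * a2 - lame f i x * lame f j x * a3
      + lame f j x * lame f k x * a1) / 2
  simpa [hf.lame_ne_zero hx] using h

/-- Dupin's theorem and `|Nⱼ| = 1` leave only the `Nᵢ` component, which is read off from `∂ᵢ∂ⱼf =
∂ⱼ∂ᵢf`. -/
theorem pd_unitNormal_of_ne (hf : IsTOS U f) (hU : IsOpen U) (hx : x ∈ U) {i j : Fin 3}
    (hij : i ≠ j) : pd i (unitNormal f j) x = rot f j i x • unitNormal f i x := by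
  refine eq_of_inner_orthonormal (hf.orthonormal_unitNormal hx) fun k => ?_
  rw [real_inner_smul_left, hf.inner_unitNormal hx]
  by_cases hik : i = k
  · subst hik
    have h := hf.lame_mul_inner_pd_unitNormal_comm hU hx i j i
    rw [hf.inner_pd_unitNormal_self hU hx] at h
    simp only [hij.symm, if_false, if_true, mul_zero, add_zero, mul_one, zero_add] at h ⊢
    rw [rot, ← h, mul_div_cancel_left₀ _ (hf.lame_ne_zero hx j)]
  · by_cases hjk : j = k
    · subst hjk
      simp [hf.inner_pd_unitNormal_self hU hx, hik]
    · simp [hf.inner_pd_unitNormal_of_ne hU hx hij hjk hik, hik]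

theorem pd_unitNormal_self (hf : IsTOS U f) (hU : IsOpen U) (hx : x ∈ U) (i : Fin 3) :
    pd i (unitNormal f i) x = -rot f (i + 1) i x • unitNormal f (i + 1) x
      - rot f (i + 2) i x • unitNormal f (i + 2) x := by
  have h1 : i ≠ i + 1 := by revert i; decide
  have h2 : i ≠ i + 2 := by revert i; decide
  have h3 : i + 1 ≠ i + 2 := by revert i; decide
  refine eq_of_inner_orthonormal (hf.orthonormal_unitNormal hx) fun k => ?_
  rw [inner_sub_left, real_inner_smul_left, real_inner_smul_left, hf.inner_unitNormal hx,
    hf.inner_unitNormal hx, hf.inner_pd_unitNormal_antisymm hU hx]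
  by_cases hik : i = k
  · subst hik
    simp [hf.inner_pd_unitNormal_self hU hx, h1.symm, h2.symm]
  · rw [hf.pd_unitNormal_of_ne hU hx hik, real_inner_smul_left, hf.inner_unitNormal hx]
    rcases fin_three_cases hik with rfl | rfl
    · simp [h3.symm]
    · simp [h3]

/-- Scaling the partial derivatives of a triply orthogonal system by nonvanishing factors. -/
theorem combescurePair (hf : IsTOS U f) {g : E3 → E3} (hg : ContDiffOn ℝ ∞ g U)
    (h : Fin 3 → E3 → ℝ) (h0 : ∀ x ∈ U, ∀ i, h i x ≠ 0)
    (hpd : ∀ x ∈ U, ∀ i, pd i g x = h i x • pd i f x) : IsCombescurePair U f g where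
  tos_left := hf
  tos_right :=
    { smooth := hg
      det_ne_zero := fun x hx => by
        have : (Matrix.of fun i j : Fin 3 => pd i g x j) =
            Matrix.of fun i j => h i x * (Matrix.of fun i j : Fin 3 => pd i f x j) i j := by
          ext i j
          simp [hpd x hx i]
        rw [this, Matrix.det_mul_column]
        exact mul_ne_zero (Finset.prod_ne_zero_iff.2 fun i _ => h0 x hx i) (hf.det_ne_zero x hx)
      orthogonal := fun x hx i j hij => by
        rw [hpd x hx, hpd x hx, real_inner_smul_left, real_inner_smul_right,
          hf.orthogonal x hx i j hij, mul_zero, mul_zero] }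
  parallel := fun x hx i => ⟨h i x, hpd x hx i⟩

end IsTOS

end TriplyOrthogonalSystem

/-! ### Ribaucour pairs and their induced maps. -/

section RibaucourPair

variable {U : Set E3} {f f' : E3 → E3} {γ : Fin 3 → E3 → ℝ} {φ : E3 → ℝ} {x : E3}

namespace IsRibaucourPair

theorem contDiffOn_inducedBar (hR : IsRibaucourPair U f f' γ φ) (hU : IsOpen U) :
    ContDiffOn ℝ ∞ (inducedBar f γ) U :=
  ContDiffOn.sum fun i _ => (hR.smooth_γ i).smul (hR.tos_left.contDiffOn_unitNormal hU i)

theorem contDiffOn_normSqData (hR : IsRibaucourPair U f f' γ φ) :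
    ContDiffOn ℝ ∞ (normSqData γ) U :=
  ContDiffOn.sum fun i _ => (hR.smooth_γ i).pow 2

theorem contDiffOn_theta (hR : IsRibaucourPair U f f' γ φ) (hU : IsOpen U) (i : Fin 3) :
    ContDiffOn ℝ ∞ (theta f γ i) U :=
  ((contDiffOn_pd hU (hR.smooth_γ i) i).add
    ((hR.tos_left.contDiffOn_rot hU (i + 1) i).mul (hR.smooth_γ (i + 1)))).add
    ((hR.tos_left.contDiffOn_rot hU (i + 2) i).mul (hR.smooth_γ (i + 2)))

theorem contDiffOn_ribaucourLame (hR : IsRibaucourPair U f f' γ φ) (hU : IsOpen U) (i : Fin 3) :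
    ContDiffOn ℝ ∞ (ribaucourLame f γ φ i) U :=
  (hR.tos_left.contDiffOn_lame hU i).sub
    (((contDiffOn_const.mul hR.smooth_φ).mul (hR.contDiffOn_theta hU i)).div
      hR.contDiffOn_normSqData hR.normSq_ne_zero)

theorem inner_inducedBar (hR : IsRibaucourPair U f f' γ φ) (hx : x ∈ U) (i : Fin 3) :
    inner ℝ (inducedBar f γ x) (unitNormal f i x) = γ i x := by
  simp only [inducedBar, sum_inner, real_inner_smul_left, hR.tos_left.inner_unitNormal hx]
  simp

theorem norm_inducedBar_sq (hR : IsRibaucourPair U f f' γ φ) (hx : x ∈ U) :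
    ‖inducedBar f γ x‖ ^ 2 = normSqData γ x := by
  rw [← real_inner_self_eq_norm_sq]
  nth_rw 2 [inducedBar]
  simp only [inner_sum, real_inner_smul_right, hR.inner_inducedBar hx, normSqData, sq]

/-- The equations `∂ᵢγⱼ = βⱼᵢγᵢ` cancel every component of the derivative except the one along `Nᵢ`.
-/
theorem pd_inducedBar (hR : IsRibaucourPair U f f' γ φ) (hU : IsOpen U) (hx : x ∈ U)
    (i : Fin 3) : pd i (inducedBar f γ) x = theta f γ i x • unitNormal f i x := by
  have h1 : i ≠ i + 1 := by revert i; decide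
  have h2 : i ≠ i + 2 := by revert i; decide
  have hN := fun j => hR.tos_left.differentiableAt_unitNormal hU hx j
  have hγ := fun j => differentiableAt_of_contDiffOn hU (hR.smooth_γ j) hx
  change pd i (fun y => ∑ j, γ j y • unitNormal f j y) x = _
  rw [pd_sum _ (fun j => (hγ j).fun_smul (hN j))]
  simp only [fun j => pd_smul (hγ j) (hN j) i]
  rw [sum_fin_three_cyclic _ i, hR.deriv_γ x hx i _ h1, hR.deriv_γ x hx i _ h2,
    hR.tos_left.pd_unitNormal_self hU hx, hR.tos_left.pd_unitNormal_of_ne hU hx h1,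
    hR.tos_left.pd_unitNormal_of_ne hU hx h2, theta]
  module

theorem norm_pd_inducedBar_sq (hR : IsRibaucourPair U f f' γ φ) (hU : IsOpen U) (hx : x ∈ U)
    (i : Fin 3) : ‖pd i (inducedBar f γ) x‖ ^ 2 = theta f γ i x ^ 2 := by
  rw [hR.pd_inducedBar hU hx, norm_smul, hR.tos_left.norm_unitNormal hx, mul_one,
    Real.norm_eq_abs, sq_abs]

theorem pd_normSqData (hR : IsRibaucourPair U f f' γ φ) (hU : IsOpen U) (hx : x ∈ U)
    (i : Fin 3) : pd i (normSqData γ) x = 2 * γ i x * theta f γ i x := by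
  have hd := differentiableAt_of_contDiffOn hU (hR.contDiffOn_inducedBar hU) hx
  rw [pd_congr_of_isOpen hU
    (h := fun y => inner ℝ (inducedBar f γ y) (inducedBar f γ y))
    (fun y hy => by rw [real_inner_self_eq_norm_sq, hR.norm_inducedBar_sq hy]) hx,
    pd_inner hd hd, hR.pd_inducedBar hU hx, real_inner_smul_right, real_inner_smul_left,
    real_inner_comm (inducedBar f γ x), hR.inner_inducedBar hx]
  ring

/-- The normals of the Ribaucour transform. -/
def reflectedNormal (f : E3 → E3) (γ : Fin 3 → E3 → ℝ) (i : Fin 3) (x : E3) : E3 :=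
  unitNormal f i x - (2 * γ i x / normSqData γ x) • inducedBar f γ x

theorem norm_reflectedNormal_sq (hR : IsRibaucourPair U f f' γ φ) (hx : x ∈ U) (i : Fin 3) :
    ‖reflectedNormal f γ i x‖ ^ 2 = 1 := by
  have hA := hR.normSq_ne_zero x hx
  rw [reflectedNormal, norm_sub_sq_real, norm_smul, mul_pow, hR.norm_inducedBar_sq hx,
    hR.tos_left.norm_unitNormal hx, real_inner_smul_right, real_inner_comm,
    hR.inner_inducedBar hx, Real.norm_eq_abs, sq_abs]
  field_simp
  ring

theorem pd_transform (hR : IsRibaucourPair U f f' γ φ) (hU : IsOpen U) (hx : x ∈ U)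
    (i : Fin 3) : pd i f' x = ribaucourLame f γ φ i x • reflectedNormal f γ i x := by
  have hA := hR.normSq_ne_zero x hx
  have dA := differentiableAt_of_contDiffOn hU hR.contDiffOn_normSqData hx
  have dB := differentiableAt_of_contDiffOn hU (hR.contDiffOn_inducedBar hU) hx
  have dφ := differentiableAt_of_contDiffOn hU hR.smooth_φ hx
  have df := differentiableAt_of_contDiffOn hU hR.tos_left.smooth hx
  have dAi : DifferentiableAt ℝ (fun y => (normSqData γ y)⁻¹) x := dA.inv hA
  have dq : DifferentiableAt ℝ (fun y => φ y * (normSqData γ y)⁻¹) x := dφ.mul dAi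
  rw [pd_congr_of_isOpen hU
      (h := fun y => f y - (2 : ℝ) • ((φ y * (normSqData γ y)⁻¹) • inducedBar f γ y))
      (fun y hy => by rw [hR.transform y hy, smul_smul]; ring_nf) hx,
    pd_sub df ((dq.fun_smul dB).fun_const_smul (2 : ℝ)),
    pd_smul (differentiableAt_const (2 : ℝ)) (dq.fun_smul dB), pd_const, pd_smul dq dB,
    pd_mul dφ dAi, pd_inv dA hA, hR.pd_inducedBar hU hx, hR.pd_normSqData hU hx,
    hR.deriv_φ x hx, hR.tos_left.pd_eq hx, reflectedNormal, ribaucourLame]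
  match_scalars <;> field_simp
  ring

theorem norm_pd_transform_sq (hR : IsRibaucourPair U f f' γ φ) (hU : IsOpen U) (hx : x ∈ U)
    (i : Fin 3) : ‖pd i f' x‖ ^ 2 = ribaucourLame f γ φ i x ^ 2 := by
  rw [hR.pd_transform hU hx, norm_smul, mul_pow, hR.norm_reflectedNormal_sq hx, mul_one,
    Real.norm_eq_abs, sq_abs]

theorem ribaucourLame_ne_zero (hR : IsRibaucourPair U f f' γ φ) (hU : IsOpen U) (hx : x ∈ U)
    (i : Fin 3) : ribaucourLame f γ φ i x ≠ 0 := by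
  intro h
  have := hR.pd_transform hU hx i
  rw [h, zero_smul] at this
  exact hR.tos_right.pd_ne_zero hx i this

/-- This is the compatibility condition of `∂ᵢf̄ = θᵢNᵢ`: the `Nⱼ` component of `∂ᵢ∂ⱼf̄ = ∂ⱼ∂ᵢf̄`.
It holds even where some `θᵢ` vanish. -/
theorem pd_theta (hR : IsRibaucourPair U f f' γ φ) (hU : IsOpen U) (hx : x ∈ U) {i j : Fin 3}
    (hij : i ≠ j) : pd i (theta f γ j) x = rot f i j x * theta f γ i x := by
  have key : ∀ a b, pd a (pd b (inducedBar f γ)) x =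
      theta f γ b x • pd a (unitNormal f b) x + pd a (theta f γ b) x • unitNormal f b x := by
    intro a b
    rw [pd_congr_of_isOpen hU (fun y hy => hR.pd_inducedBar hU hy b) hx,
      pd_smul (differentiableAt_of_contDiffOn hU (hR.contDiffOn_theta hU b) hx)
        (hR.tos_left.differentiableAt_unitNormal hU hx b)]
  have h := pd_comm hU (hR.contDiffOn_inducedBar hU) hx i j
  rw [key, key, hR.tos_left.pd_unitNormal_of_ne hU hx hij,
    hR.tos_left.pd_unitNormal_of_ne hU hx hij.symm] at h
  have h' := congrArg (fun v => inner ℝ v (unitNormal f j x)) h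
  simp only [inner_add_left, real_inner_smul_left, hR.tos_left.inner_unitNormal hx, hij,
    if_true, if_false] at h'
  linarith

theorem inducedBar'_eq (hR : IsRibaucourPair U f f' γ φ) (hx : x ∈ U) :
    inducedBar' f γ x = (normSqData γ x)⁻¹ • inducedBar f γ x := by
  rw [inducedBar', hR.norm_inducedBar_sq hx]

theorem contDiffOn_inducedBar' (hR : IsRibaucourPair U f f' γ φ) (hU : IsOpen U) :
    ContDiffOn ℝ ∞ (inducedBar' f γ) U :=
  ((hR.contDiffOn_normSqData.inv hR.normSq_ne_zero).smul (hR.contDiffOn_inducedBar hU)).congr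
    fun _ hy => hR.inducedBar'_eq hy

theorem pd_inducedBar' (hR : IsRibaucourPair U f f' γ φ) (hU : IsOpen U) (hx : x ∈ U)
    (i : Fin 3) : pd i (inducedBar' f γ) x =
      (theta f γ i x / normSqData γ x) • reflectedNormal f γ i x := by
  have hA := hR.normSq_ne_zero x hx
  have dA := differentiableAt_of_contDiffOn hU hR.contDiffOn_normSqData hx
  have dB := differentiableAt_of_contDiffOn hU (hR.contDiffOn_inducedBar hU) hx
  have dAi : DifferentiableAt ℝ (fun y => (normSqData γ y)⁻¹) x := dA.inv hA
  rw [pd_congr_of_isOpen hU (fun y hy => hR.inducedBar'_eq hy) hx, pd_smul dAi dB,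
    pd_inv dA hA, hR.pd_inducedBar hU hx, hR.pd_normSqData hU hx, reflectedNormal]
  match_scalars <;> field_simp

theorem norm_inducedBar'_sq (hR : IsRibaucourPair U f f' γ φ) (hx : x ∈ U) :
    ‖inducedBar' f γ x‖ ^ 2 = (normSqData γ x)⁻¹ := by
  have hA := hR.normSq_ne_zero x hx
  rw [hR.inducedBar'_eq hx, norm_smul, mul_pow, hR.norm_inducedBar_sq hx, Real.norm_eq_abs,
    sq_abs]
  field_simp

theorem norm_pd_inducedBar'_sq (hR : IsRibaucourPair U f f' γ φ) (hU : IsOpen U) (hx : x ∈ U)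
    (i : Fin 3) :
    ‖pd i (inducedBar' f γ) x‖ ^ 2 = theta f γ i x ^ 2 / normSqData γ x ^ 2 := by
  rw [hR.pd_inducedBar' hU hx, norm_smul, mul_pow, hR.norm_reflectedNormal_sq hx, mul_one,
    Real.norm_eq_abs, sq_abs, div_pow]

theorem combescurePair_inducedBar (hR : IsRibaucourPair U f f' γ φ) (hU : IsOpen U)
    (hθ : ∀ x ∈ U, ∀ i, theta f γ i x ≠ 0) : IsCombescurePair U f (inducedBar f γ) :=
  hR.tos_left.combescurePair (hR.contDiffOn_inducedBar hU)
    (fun i y => theta f γ i y / lame f i y)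
    (fun y hy i => div_ne_zero (hθ y hy i) (hR.tos_left.lame_ne_zero hy i))
    fun y hy i => by
      rw [hR.pd_inducedBar hU hy, hR.tos_left.pd_eq hy, smul_smul,
        div_mul_cancel₀ _ (hR.tos_left.lame_ne_zero hy i)]

theorem combescurePair_inducedBar' (hR : IsRibaucourPair U f f' γ φ) (hU : IsOpen U)
    (hθ : ∀ x ∈ U, ∀ i, theta f γ i x ≠ 0) : IsCombescurePair U f' (inducedBar' f γ) :=
  hR.tos_right.combescurePair (hR.contDiffOn_inducedBar' hU)
    (fun i y => theta f γ i y / normSqData γ y / ribaucourLame f γ φ i y)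
    (fun y hy i => div_ne_zero (div_ne_zero (hθ y hy i) (hR.normSq_ne_zero y hy))
      (hR.ribaucourLame_ne_zero hU hy i))
    fun y hy i => by
      rw [hR.pd_inducedBar' hU hy, hR.pd_transform hU hy, smul_smul,
        div_mul_cancel₀ _ (hR.ribaucourLame_ne_zero hU hy i)]

end IsRibaucourPair

/-- The diagonal bilinear form `∑ εᵢ uᵢ vᵢ`. -/
def diagForm (ε : Fin 3 → ℝ) (u v : Fin 3 → E3 → ℝ) (x : E3) : ℝ :=
  ∑ i, ε i * (u i x * v i x)

theorem pd_diagForm (ε : Fin 3 → ℝ) {u v : Fin 3 → E3 → ℝ}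
    (hu : ∀ i, DifferentiableAt ℝ (u i) x) (hv : ∀ i, DifferentiableAt ℝ (v i) x) (i : Fin 3) :
    pd i (diagForm ε u v) x = ∑ j, ε j * (u j x * pd i (v j) x + pd i (u j) x * v j x) := by
  change pd i (fun y => ∑ j, ε j * (u j y * v j y)) x = _
  rw [pd_sum _ (fun j => ((hu j).fun_mul (hv j)).const_mul (ε j))]
  refine Finset.sum_congr rfl fun j _ => ?_
  rw [pd_mul (differentiableAt_const (ε j)) ((hu j).fun_mul (hv j)), pd_const,
    pd_mul (hu j) (hv j)]
  ring

theorem contDiffOn_diagForm (ε : Fin 3 → ℝ) {u v : Fin 3 → E3 → ℝ}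
    (hu : ∀ i, ContDiffOn ℝ ∞ (u i) U) (hv : ∀ i, ContDiffOn ℝ ∞ (v i) U) :
    ContDiffOn ℝ ∞ (diagForm ε u v) U :=
  ContDiffOn.sum fun i _ => contDiffOn_const.mul ((hu i).mul (hv i))

/-- Differentiating the null condition and dividing by `2Hᵢ` expresses the one derivative of `Hᵢ`
that the rotational coefficients do not control. -/
theorem IsTOS.mul_pd_lame_self (hf : IsTOS U f) (hU : IsOpen U) {ε : Fin 3 → ℝ}
    (hnull : ∀ x ∈ U, diagForm ε (lame f) (lame f) x = 0) (hx : x ∈ U) (i : Fin 3) :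
    ε i * pd i (lame f i) x = -(ε (i + 1) * rot f i (i + 1) x * lame f (i + 1) x
      + ε (i + 2) * rot f i (i + 2) x * lame f (i + 2) x) := by
  have hd := fun j => hf.differentiableAt_lame hU hx j
  have h := pd_diagForm ε hd hd i
  rw [pd_congr_of_isOpen hU hnull hx i, pd_const, sum_fin_three_cyclic _ i,
    hf.pd_lame hx i (i + 1), hf.pd_lame hx i (i + 2)] at h
  rw [← mul_right_inj' (hf.lame_ne_zero hx i)]
  linear_combination -h / 2

/-! ### Constancy of `S/A` for two Guichard nets. -/

namespace IsRibaucourPair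

/-- The difference of the two null conditions is this identity times `4φ/A²`. The factor `φ` can be
cancelled because its zero set has empty interior. -/
theorem diagForm_theta_mul (hR : IsRibaucourPair U f f' γ φ) (hU : IsOpen U) {ε : Fin 3 → ℝ}
    (hnull : ∀ x ∈ U, diagForm ε (lame f) (lame f) x = 0)
    (hnull' : ∀ x ∈ U, diagForm ε (ribaucourLame f γ φ) (ribaucourLame f γ φ) x = 0)
    (hx : x ∈ U) :
    diagForm ε (theta f γ) (theta f γ) x * φ x =
      normSqData γ x * diagForm ε (lame f) (theta f γ) x := by
  have off : ∀ y ∈ U, φ y ≠ 0 → diagForm ε (theta f γ) (theta f γ) y * φ y =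
      normSqData γ y * diagForm ε (lame f) (theta f γ) y := by
    intro y hy hφ
    have hA := hR.normSq_ne_zero y hy
    have h0 := hnull y hy
    have h1 := hnull' y hy
    simp only [diagForm, ribaucourLame, Fin.sum_univ_three] at h0 h1 ⊢
    field_simp at h1
    have : φ y * ((ε 0 * (theta f γ 0 y * theta f γ 0 y) + ε 1 * (theta f γ 1 y * theta f γ 1 y)
        + ε 2 * (theta f γ 2 y * theta f γ 2 y)) * φ y) = φ y * (normSqData γ y *
        (ε 0 * (lame f 0 y * theta f γ 0 y) + ε 1 * (lame f 1 y * theta f γ 1 y)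
        + ε 2 * (lame f 2 y * theta f γ 2 y))) := by
      linear_combination (h1 - normSqData γ y ^ 2 * h0) / 4
    exact mul_left_cancel₀ hφ this
  by_contra hne
  have hcont : ContinuousOn (fun y => diagForm ε (theta f γ) (theta f γ) y * φ y -
      normSqData γ y * diagForm ε (lame f) (theta f γ) y) U :=
    (((contDiffOn_diagForm ε (hR.contDiffOn_theta hU) (hR.contDiffOn_theta hU)).mul
      hR.smooth_φ).sub (hR.contDiffOn_normSqData.mul
        (contDiffOn_diagForm ε (hR.tos_left.contDiffOn_lame hU)
          (hR.contDiffOn_theta hU)))).continuousOn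
  have hev := (hcont.continuousAt (hU.mem_nhds hx)).eventually_ne (sub_ne_zero.2 hne)
  -- A failure at `x` persists nearby by continuity, so `φ` vanishes near `x`; then `∂ᵢφ = Hᵢγᵢ`
  -- forces all `γᵢ = 0` at `x`, against `A ≠ 0`.
  have hφ0 : φ =ᶠ[nhds x] fun _ => 0 := by
    filter_upwards [hev, hU.mem_nhds hx] with y hy hyU
    by_contra h
    exact hy (sub_eq_zero.2 (off y hyU h))
  refine hR.normSq_ne_zero x hx (Finset.sum_eq_zero fun i _ => ?_)
  have h := hR.deriv_φ x hx i
  rw [pd, hφ0.fderiv_eq] at h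
  have : γ i x = 0 := by simpa [hR.tos_left.lame_ne_zero hx] using h
  simp [this]

theorem exists_ne_zero (hR : IsRibaucourPair U f f' γ φ) (hU : IsOpen U) (hne : U.Nonempty) :
    ∃ x ∈ U, φ x ≠ 0 := by
  by_contra! h
  obtain ⟨x, hx⟩ := hne
  refine hR.normSq_ne_zero x hx (Finset.sum_eq_zero fun i _ => ?_)
  have h1 := hR.deriv_φ x hx i
  rw [pd_congr_of_isOpen hU h hx, pd_const] at h1
  have : γ i x = 0 := by simpa [hR.tos_left.lame_ne_zero hx] using h1.symm
  simp [this]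

theorem normSqData_mul_pd_diagForm_theta (hR : IsRibaucourPair U f f' γ φ) (hU : IsOpen U)
    {ε : Fin 3 → ℝ} (hnull : ∀ x ∈ U, diagForm ε (lame f) (lame f) x = 0)
    (hnull' : ∀ x ∈ U, diagForm ε (ribaucourLame f γ φ) (ribaucourLame f γ φ) x = 0)
    (hx : x ∈ U) (i : Fin 3) :
    normSqData γ x * pd i (diagForm ε (theta f γ) (theta f γ)) x =
      2 * γ i x * theta f γ i x * diagForm ε (theta f γ) (theta f γ) x := by
  have h1 : i ≠ i + 1 := by revert i; decide
  have h2 : i ≠ i + 2 := by revert i; decide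
  have hA := hR.normSq_ne_zero x hx
  have dA := differentiableAt_of_contDiffOn hU hR.contDiffOn_normSqData hx
  have dφ := differentiableAt_of_contDiffOn hU hR.smooth_φ hx
  have dθ := fun j => differentiableAt_of_contDiffOn hU (hR.contDiffOn_theta hU j) hx
  have dH := fun j => hR.tos_left.differentiableAt_lame hU hx j
  have dS := differentiableAt_of_contDiffOn hU
    (contDiffOn_diagForm ε (hR.contDiffOn_theta hU) (hR.contDiffOn_theta hU)) hx
  have dP := differentiableAt_of_contDiffOn hU
    (contDiffOn_diagForm ε (hR.tos_left.contDiffOn_lame hU) (hR.contDiffOn_theta hU)) hx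
  have hS := pd_diagForm ε dθ dθ i
  have hP := pd_diagForm ε dH dθ i
  have hself := hR.tos_left.mul_pd_lame_self hU hnull hx i
  rw [sum_fin_three_cyclic _ i, hR.pd_theta hU hx h1, hR.pd_theta hU hx h2] at hS hP
  rw [hR.tos_left.pd_lame hx i (i + 1), hR.tos_left.pd_lame hx i (i + 2)] at hP
  have hc := hR.diagForm_theta_mul hU hnull hnull' hx
  have hd := pd_congr_of_isOpen hU (fun y hy => hR.diagForm_theta_mul hU hnull hnull' hy) hx i
  rw [pd_mul dS dφ, pd_mul dA dP, hR.pd_normSqData hU hx, hR.deriv_φ x hx] at hd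
  have hH' := hR.ribaucourLame_ne_zero hU hx i
  rw [ribaucourLame] at hH'
  -- This factor is `AHᵢ'`, nonzero because `f'` is an immersion.
  have hne : normSqData γ x * lame f i x - 2 * φ x * theta f γ i x ≠ 0 := by
    intro h
    apply hH'
    field_simp
    linear_combination h
  generalize diagForm ε (theta f γ) (theta f γ) x = S at *
  generalize diagForm ε (lame f) (theta f γ) x = P at *
  generalize pd i (diagForm ε (theta f γ) (theta f γ)) x = S' at *
  generalize pd i (diagForm ε (lame f) (theta f γ)) x = P' at *
  -- `T` is the common factor of `∂ᵢS = 2θᵢT` and `∂ᵢP = HᵢT`; the terms of `∂ᵢP` proportional to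
  -- `θᵢ` cancel by `hself`.
  set T := ε i * pd i (theta f γ i) x + ε (i + 1) * rot f i (i + 1) x * theta f γ (i + 1) x
    + ε (i + 2) * rot f i (i + 2) x * theta f γ (i + 2) x with hT
  have hS' : S' = 2 * theta f γ i x * T := by rw [hS, hT]; ring
  have hP' : P' = lame f i x * T := by
    rw [hP, hT]; linear_combination theta f γ i x * hself
  have hTS : normSqData γ x * T = S * γ i x := by
    have : (normSqData γ x * lame f i x - 2 * φ x * theta f γ i x) * (normSqData γ x * T) =
        (normSqData γ x * lame f i x - 2 * φ x * theta f γ i x) * (S * γ i x) := by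
      rw [hS', hP'] at hd
      -- `A` times the derivative of `φS = AP`, with `AP` replaced by `φS`.
      linear_combination (-normSqData γ x) * hd + 2 * γ i x * theta f γ i x * hc
    exact mul_left_cancel₀ hne this
  rw [hS']
  linear_combination 2 * theta f γ i x * hTS

theorem exists_diagForm_theta_eq (hR : IsRibaucourPair U f f' γ φ) (hU : IsOpen U)
    (hUc : IsConnected U) {ε : Fin 3 → ℝ} (hnull : ∀ x ∈ U, diagForm ε (lame f) (lame f) x = 0)
    (hnull' : ∀ x ∈ U, diagForm ε (ribaucourLame f γ φ) (ribaucourLame f γ φ) x = 0) :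
    ∃ c : ℝ, ∀ x ∈ U, diagForm ε (theta f γ) (theta f γ) x = c * normSqData γ x := by
  have hS := contDiffOn_diagForm ε (hR.contDiffOn_theta hU) (hR.contDiffOn_theta hU)
  have hq : ContDiffOn ℝ ∞
      (fun x => diagForm ε (theta f γ) (theta f γ) x * (normSqData γ x)⁻¹) U :=
    hS.mul (hR.contDiffOn_normSqData.inv hR.normSq_ne_zero)
  obtain ⟨c, hc⟩ := hU.exists_is_const_of_fderiv_eq_zero hUc.isPreconnected
    (hq.differentiableOn (by simp)) fun x hx => fderiv_eq_zero_of_pd fun i => by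
      have hA := hR.normSq_ne_zero x hx
      have dA := differentiableAt_of_contDiffOn hU hR.contDiffOn_normSqData hx
      have h := hR.normSqData_mul_pd_diagForm_theta hU hnull hnull' hx i
      have dAi : DifferentiableAt ℝ (fun y => (normSqData γ y)⁻¹) x := dA.inv hA
      rw [pd_mul (differentiableAt_of_contDiffOn hU hS hx) dAi, pd_inv dA hA, hR.pd_normSqData hU hx]
      field_simp
      linear_combination h
  refine ⟨c, fun x hx => ?_⟩
  rw [← hc x hx, mul_assoc, inv_mul_cancel₀ (hR.normSq_ne_zero x hx), mul_one]

end IsRibaucourPair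

/-! ### The sign of the constant. -/

theorem exists_sign_of_ne_zero {X : Type*} [TopologicalSpace X] {s : Set X}
    (hs : IsPreconnected s) {g : X → ℝ} (hg : ContinuousOn g s) (h0 : ∀ x ∈ s, g x ≠ 0) :
    ∃ σ : ℝ, (σ = 1 ∨ σ = -1) ∧ ∀ x ∈ s, 0 < σ * g x := by
  by_cases hpos : ∃ a ∈ s, 0 < g a
  · obtain ⟨a, ha, hga⟩ := hpos
    refine ⟨1, Or.inl rfl, fun x hx => ?_⟩
    by_contra! hx'
    obtain ⟨y, hy, hy0⟩ := hs.intermediate_value hx ha hg ⟨by linarith, hga.le⟩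
    exact h0 y hy hy0
  · push Not at hpos
    exact ⟨-1, Or.inr rfl, fun x hx => by
      linarith [lt_of_le_of_ne (hpos x hx) (h0 x hx)]⟩

/-- Null vectors for the form of signature `(+, +, -)` have a product whose sign is opposite to
that of the product of their time-like components. -/
theorem mul_minkowski_nonpos {a₀ a₁ a₂ b₀ b₁ b₂ σ : ℝ} (hσ : σ = 1 ∨ σ = -1)
    (ha : a₀ ^ 2 + a₁ ^ 2 - a₂ ^ 2 = 0) (hb : b₀ ^ 2 + b₁ ^ 2 - b₂ ^ 2 = 0)
    (h : 0 < σ * (a₂ * b₂)) : σ * (a₀ * b₀ + a₁ * b₁ - a₂ * b₂) ≤ 0 := by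
  have hσ2 : σ ^ 2 = 1 := by rcases hσ with rfl | rfl <;> norm_num
  -- Nullity turns the right side into `(a₀² + a₁²)(b₀² + b₁²)`, so this is Cauchy–Schwarz in the
  -- plane.
  have key : (σ * (a₀ * b₀ + a₁ * b₁)) ^ 2 ≤ (σ * (a₂ * b₂)) ^ 2 := by
    rw [mul_pow, mul_pow, hσ2, mul_pow a₂, show a₂ ^ 2 = a₀ ^ 2 + a₁ ^ 2 by linarith,
      show b₂ ^ 2 = b₀ ^ 2 + b₁ ^ 2 by linarith]
    nlinarith [sq_nonneg (a₀ * b₁ - a₁ * b₀)]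
  have := le_of_sq_le_sq key h.le
  linarith

theorem diagForm_minkowski (u v : Fin 3 → E3 → ℝ) (x : E3) :
    diagForm ![1, 1, -1] u v x = u 0 x * v 0 x + u 1 x * v 1 x - u 2 x * v 2 x := by
  simp [diagForm, Fin.sum_univ_three, sub_eq_add_neg]

theorem IsCombescurePair.isChiSystem {g : E3 → E3} (h : IsCombescurePair U f g) {χ : E3 → ℝ}
    (hχ : ∀ x ∈ U, minkowskiTrace g x = χ x) : IsChiSystem U χ g where
  tos := h.tos_right
  trace := fun x hx => by
    rw [h.tos_right.lame_sq hx, h.tos_right.lame_sq hx, h.tos_right.lame_sq hx]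
    exact hχ x hx

end RibaucourPair

end TriplyOrthogonal

end

/-! ### Proof of the proposition. -/

open TriplyOrthogonal in
theorem mainTheorem9 (U : Set TriplyOrthogonal.E3) (hU : IsOpen U) (hUc : IsConnected U)
    (f f' : TriplyOrthogonal.E3 → TriplyOrthogonal.E3)
    (γ : Fin 3 → TriplyOrthogonal.E3 → ℝ) (φ : TriplyOrthogonal.E3 → ℝ)
    (hR : TriplyOrthogonal.IsRibaucourPair U f f' γ φ)
    (hf : TriplyOrthogonal.IsGuichardNet U f)
    (hf' : TriplyOrthogonal.IsGuichardNet U f') :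
    ∃ α σ : ℝ, (σ = 1 ∨ σ = -1) ∧
      (∀ x ∈ U, 0 < σ * (TriplyOrthogonal.lame f 2 x *
        TriplyOrthogonal.ribaucourLame f γ φ 2 x)) ∧
      (∀ x ∈ U, TriplyOrthogonal.minkowskiTrace (TriplyOrthogonal.inducedBar f γ) x =
        σ * α ^ 2 * ‖TriplyOrthogonal.inducedBar f γ x‖ ^ 2) ∧
      (∀ x ∈ U, TriplyOrthogonal.minkowskiTrace (TriplyOrthogonal.inducedBar' f γ) x =
        σ * α ^ 2 * ‖TriplyOrthogonal.inducedBar' f γ x‖ ^ 2) ∧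
      ((∀ x ∈ U, ∀ i, TriplyOrthogonal.theta f γ i x ≠ 0) →
        TriplyOrthogonal.IsCombescurePair U f (TriplyOrthogonal.inducedBar f γ) ∧
        TriplyOrthogonal.IsCombescurePair U f' (TriplyOrthogonal.inducedBar' f γ) ∧
        TriplyOrthogonal.IsChiSystem U
          (fun x => σ * α ^ 2 * ‖TriplyOrthogonal.inducedBar f γ x‖ ^ 2)
          (TriplyOrthogonal.inducedBar f γ) ∧
        TriplyOrthogonal.IsChiSystem U
          (fun x => σ * α ^ 2 * ‖TriplyOrthogonal.inducedBar' f γ x‖ ^ 2)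
          (TriplyOrthogonal.inducedBar' f γ)) := by
  have hH : ∀ x ∈ U, lame f 0 x ^ 2 + lame f 1 x ^ 2 - lame f 2 x ^ 2 = 0 := hf.trace
  -- `lame f'` and `ribaucourLame` refer to normals that may differ in sign, but their squares agree
  -- with `|∂ᵢf'|²`.
  have hH' : ∀ x ∈ U, ribaucourLame f γ φ 0 x ^ 2 + ribaucourLame f γ φ 1 x ^ 2
      - ribaucourLame f γ φ 2 x ^ 2 = 0 := fun x hx => by
    simp only [← hR.norm_pd_transform_sq hU hx, ← hR.tos_right.lame_sq hx]
    exact hf'.trace x hx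
  obtain ⟨c, hc⟩ := hR.exists_diagForm_theta_eq hU hUc (ε := ![1, 1, -1])
    (fun x hx => by rw [diagForm_minkowski, ← hH x hx]; ring)
    (fun x hx => by rw [diagForm_minkowski, ← hH' x hx]; ring)
  have hθ : ∀ x ∈ U, theta f γ 0 x ^ 2 + theta f γ 1 x ^ 2 - theta f γ 2 x ^ 2 =
      c * normSqData γ x := fun x hx => by rw [← hc x hx, diagForm_minkowski]; ring
  obtain ⟨σ, hσ, hpos⟩ := exists_sign_of_ne_zero hUc.isPreconnected
    (g := fun x => lame f 2 x * ribaucourLame f γ φ 2 x)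
    ((hR.tos_left.contDiffOn_lame hU 2).continuousOn.mul
      (hR.contDiffOn_ribaucourLame hU 2).continuousOn)
    fun x hx => mul_ne_zero (hR.tos_left.lame_ne_zero hx 2) (hR.ribaucourLame_ne_zero hU hx 2)
  have hσ2 : σ * σ = 1 := by rcases hσ with rfl | rfl <;> norm_num
  have hApos : ∀ x ∈ U, 0 < normSqData γ x := fun x hx =>
    lt_of_le_of_ne (Finset.sum_nonneg fun i _ => sq_nonneg _) (hR.normSq_ne_zero x hx).symm
  have hσc : 0 ≤ σ * c := by
    -- Only at a point with `φ ≠ 0` does `∑ εᵢHᵢHᵢ' = -2φ²c/A` detect the sign of `c`.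
    obtain ⟨x, hx, hφ⟩ := hR.exists_ne_zero hU hUc.nonempty
    have hA := hApos x hx
    have h1 := mul_minkowski_nonpos hσ (hH x hx) (hH' x hx) (hpos x hx)
    have h2 : lame f 0 x * ribaucourLame f γ φ 0 x + lame f 1 x * ribaucourLame f γ φ 1 x
        - lame f 2 x * ribaucourLame f γ φ 2 x = -(2 * φ x ^ 2 / normSqData γ x) * c := by
      have e0 := hH x hx
      have e1 := hH' x hx
      have e2 := hθ x hx
      simp only [ribaucourLame] at e1 ⊢
      field_simp at e1 ⊢
      refine mul_left_cancel₀ hA.ne' ?_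
      -- Polarization: `H` and `H'` are null, so `-2∑ εᵢHᵢHᵢ'` is the form of `H - H' = 2φθ/A`,
      -- namely `4φ²S/A²`.
      linear_combination (e1 + normSqData γ x ^ 2 * e0 - 4 * φ x ^ 2 * e2) / 2
    rw [h2] at h1
    have h3 : 0 < 2 * φ x ^ 2 / normSqData γ x := by positivity
    nlinarith
  have hα : σ * √(σ * c) ^ 2 = c := by
    rw [Real.sq_sqrt hσc, ← mul_assoc, hσ2, one_mul]
  have ht : ∀ x ∈ U, minkowskiTrace (inducedBar f γ) x =
      σ * √(σ * c) ^ 2 * ‖inducedBar f γ x‖ ^ 2 := fun x hx => by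
    rw [hα, hR.norm_inducedBar_sq hx, ← hθ x hx, minkowskiTrace]
    simp only [hR.norm_pd_inducedBar_sq hU hx]
  have ht' : ∀ x ∈ U, minkowskiTrace (inducedBar' f γ) x =
      σ * √(σ * c) ^ 2 * ‖inducedBar' f γ x‖ ^ 2 := fun x hx => by
    have hA := (hApos x hx).ne'
    rw [hα, hR.norm_inducedBar'_sq hx, minkowskiTrace]
    simp only [hR.norm_pd_inducedBar'_sq hU hx]
    field_simp
    rw [hθ x hx, mul_comm]
  refine ⟨√(σ * c), σ, hσ, hpos, ht, ht', fun h0 => ?_⟩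
  have hC := hR.combescurePair_inducedBar hU h0
  have hC' := hR.combescurePair_inducedBar' hU h0
  exact ⟨hC, hC', hC.isChiSystem ht, hC'.isChiSystem ht'⟩
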